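/- Let $G$ be a finite simple graph of order $n$ with average degree $d=\frac1n\sum_{v}d_v$ and smallest degree $\delta>0$. Let $0=\sigma_0\le\sigma_1\le\cdots\le\sigma_{n-1}$ be the eigenvalues, with multiplicity, of its Laplacian matrix $L(G)=D(G)-A(G)$, where $D(G)$ is the diagonal matrix of vertex degrees and $A(G)$ is the adjacency matrix. Let $\theta$ be a real number such that $|d-\sigma_i|\le\theta$ for all $i\ne 0$, and suppose that $$\delta-(2+2\sqrt3)^2\,\frac{\theta^2}{\delta}\ \ge\ \frac{2n\theta+d}{d+\theta}.$$ Then $G$ is Hamiltonian, i.e. $G$ has a Hamilton cycle. -/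

import Mathlib

namespace SimpleGraph

/-- The average degree `d = vol(G) / n = (∑ v, d_v) / n` of a finite graph, as a real number. -/
noncomputable def avgDegree {V : Type*} [Fintype V] (G : SimpleGraph V) [DecidableRel G.Adj] : ℝ :=
  (∑ v : V, (G.degree v : ℝ)) / (Fintype.card V : ℝ)

/-- The Laplacian eigenvalues `σ_0 ≤ σ_1 ≤ ⋯ ≤ σ_{n-1}` of a graph on `n` vertices: the
eigenvalues, with multiplicity and in increasing order, of the Laplacian matrix `L = D - A`.
Mathlib's `eigenvalues₀` lists them in decreasing order, so the index is reversed. -/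
noncomputable def lapEigenvalue {V : Type*} [Fintype V] [DecidableEq V] (G : SimpleGraph V)
    [DecidableRel G.Adj] (i : Fin (Fintype.card V)) : ℝ :=
  (G.isHermitian_lapMatrix ℝ).eigenvalues₀ i.rev

theorem lapEigenvalue_monotone {V : Type*} [Fintype V] [DecidableEq V] (G : SimpleGraph V)
    [DecidableRel G.Adj] : Monotone G.lapEigenvalue := fun _ _ h =>
  (G.isHermitian_lapMatrix ℝ).eigenvalues₀_antitone (Fin.rev_le_rev.mpr h)

end SimpleGraph

/-! ### Cycles as vertex lists -/

namespace SimpleGraph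

/-! The proof combines the Chvátal–Erdős argument with expander mixing for the Laplacian.

If `G` is not Hamiltonian, take a longest cycle and a component `A` of its complement, and let `S`
be the set of neighbours of `A` on the cycle. Then `S` cuts `A` off from the rest, and the
successors of `S` together with a vertex of `A` are independent: any edge among them would give a
longer cycle (`exists_separator_of_not_isHamiltonian`).

Off the constants, the Laplacian is within `θ` of `d` as a quadratic form, so edge counts between
disjoint sets are nearly those of a random graph (`abs_edgesBetween_sub_le`). Applied to the
independent set, this gives `(d + θ)|S| ≤ 2nθ`, so by hypothesis `|S|` lies well below `δ`. A
separator that small is impossible: two sides with no edges between them satisfy `ab ≤ n²/20`, yet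
all edges leaving the smaller side `A` land in `S`, which forces `a ≥ n/3`
(`false_of_separator_bounds`). -/

theorem _root_.List.exists_nodup_maximal_length {α : Type*} [Fintype α] (P : List α → Prop)
    (hP : ∀ l, P l → l.Nodup) (hne : ∃ l, P l) :
    ∃ l, P l ∧ ∀ l', P l' → l'.length ≤ l.length := by
  obtain ⟨l₀, h₀⟩ := hne
  have hbdd : BddAbove {k | ∃ l, P l ∧ l.length = k} :=
    ⟨Fintype.card α, by rintro k ⟨l, hl, rfl⟩; exact (hP l hl).length_le_card⟩
  have hne : {k | ∃ l, P l ∧ l.length = k}.Nonempty := ⟨_, l₀, h₀, rfl⟩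
  obtain ⟨l, hl, hlen⟩ := Nat.sSup_mem hne hbdd
  exact ⟨l, hl, fun l' hl' => hlen ▸ le_csSup hbdd ⟨l', hl', rfl⟩⟩

/-- A list enumerating the vertices of a cycle of `G` in cyclic order. -/
structure IsCycleList {V : Type*} (G : SimpleGraph V) (l : List V) : Prop where
  three_le_length : 3 ≤ l.length
  nodup : l.Nodup
  isChain : l.IsChain G.Adj
  adj_last_head : ∀ x ∈ l.getLast?, ∀ y ∈ l.head?, G.Adj x y

variable {V : Type*} {G : SimpleGraph V}

theorem IsCycleList.append_comm {P Q : List V} (h : G.IsCycleList (P ++ Q)) :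
    G.IsCycleList (Q ++ P) := by
  rcases P.eq_nil_or_concat' with rfl | ⟨P', p, rfl⟩
  · simpa using h
  rcases Q with _ | ⟨q, Q'⟩
  · simpa using h
  obtain ⟨h1, h2, h3, h4⟩ := h
  refine ⟨by simp at h1 ⊢; omega, List.nodup_append_comm.1 h2, ?_, ?_⟩
  · rw [List.isChain_append] at h3 ⊢
    refine ⟨h3.2.1, h3.1, ?_⟩
    intro x hx y hy
    apply h4
    · simpa [List.getLast?_append, List.getLast?_cons] using hx
    · cases P' <;> simpa using hy
  · rw [List.isChain_append] at h3
    intro x hx y hy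
    rw [← List.append_assoc, List.getLast?_concat] at hx
    exact h3.2.2 x (by simpa using hx) y (by simpa using hy)

theorem IsCycleList.isRotated {l l' : List V} (h : G.IsCycleList l) (hr : l ~r l') :
    G.IsCycleList l' := by
  obtain ⟨n, rfl⟩ := hr
  rw [List.rotate_eq_drop_append_take_mod]
  apply IsCycleList.append_comm
  rwa [List.take_append_drop]

theorem isCycleList_append_path {x u : V} {m R : List V} {y z : V}
    (h1 : 3 ≤ (x :: m ++ [u]).length) (h2 : (x :: m ++ [u]).Nodup)
    (h3 : (x :: m ++ [u]).IsChain G.Adj) (hR : R.IsChain G.Adj) (hRn : R.Nodup)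
    (hy : R.head? = some y) (hz : R.getLast? = some z) (hdis : List.Disjoint (x :: m ++ [u]) R)
    (huy : G.Adj u y) (hzx : G.Adj z x) : G.IsCycleList (x :: m ++ [u] ++ R) := by
  refine ⟨by simp at h1 ⊢; omega, h2.append hRn hdis, ?_, ?_⟩
  · rw [List.isChain_append]
    refine ⟨h3, hR, ?_⟩
    intro a ha b hb
    rw [List.getLast?_concat] at ha
    simp [hy] at ha hb
    subst ha hb; exact huy
  · intro a ha b hb
    rw [List.getLast?_append, hz] at ha
    simp at ha hb
    subst ha hb; exact hzx

/-- Pósa-type exchange: reversing the initial segment `x … w` and using the chord from `x` to `x'`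
turns the path `x … w x' … u` into `w … x x' … u`. -/
theorem IsCycleList.cross {x u w x' : V} {m P Q : List V}
    (h : G.IsCycleList (x :: m ++ [u])) (hl : x :: m ++ [u] = P ++ Q)
    (hP : P.getLast? = some w) (hQ : Q.head? = some x') (hxx : G.Adj x x') :
    ∃ m', (x :: m ++ [u]).Perm (w :: m' ++ [u]) ∧ (w :: m' ++ [u]).IsChain G.Adj := by
  rcases P.eq_nil_or_concat' with rfl | ⟨P', p, rfl⟩
  · simp at hP
  simp at hP
  subst hP
  rcases Q.eq_nil_or_concat' with rfl | ⟨Q', q, rfl⟩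
  · simp at hQ
  have hq : q = u := by
    have := congrArg List.getLast? hl
    rw [← List.append_assoc, List.getLast?_concat, List.getLast?_concat] at this
    simpa using this.symm
  subst hq
  refine ⟨P'.reverse ++ Q', ?_, ?_⟩
  · rw [hl]
    have : (p :: (P'.reverse ++ Q') ++ [q]) = (P' ++ [p]).reverse ++ (Q' ++ [q]) := by simp
    rw [this]
    exact (List.reverse_perm _).symm.append_right _
  · have h3 := h.isChain
    rw [hl, List.isChain_append] at h3
    have : (p :: (P'.reverse ++ Q') ++ [q]) = (P' ++ [p]).reverse ++ (Q' ++ [q]) := by simp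
    rw [this, List.isChain_append, List.isChain_reverse]
    refine ⟨?_, h3.2.1, ?_⟩
    · exact h3.1.imp fun _ _ h => h.symm
    · intro a ha b hb
      rw [hQ] at hb
      have hx : (P' ++ [p]).head? = some x := by
        have := congrArg List.head? hl
        cases P' <;> simpa using this.symm
      rw [List.getLast?_reverse, hx] at ha
      simp at ha hb
      subst ha hb; exact hxx

/-- `l.formPerm` serves as the successor map on the cycle; cutting the cycle just after `u` gives a
path from the successor of `u` to `u`. -/
theorem exists_isRotated_formPerm [DecidableEq V] {l : List V} (hn : l.Nodup) (h2 : 2 ≤ l.length)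
    {u : V} (hu : u ∈ l) : ∃ m, l ~r (l.formPerm u :: m ++ [u]) := by
  obtain ⟨s, t, rfl⟩ := List.append_of_mem hu
  have hr : (s ++ u :: t) ~r ((t ++ s) ++ [u]) := by
    have : s ++ u :: t = (s ++ [u]) ++ t := by simp
    rw [this]
    simpa using List.isRotated_append (l := s ++ [u]) (l' := t)
  rcases hts : t ++ s with _ | ⟨x, m⟩
  · simp at hts; simp [hts] at h2
  rw [hts] at hr
  refine ⟨m, ?_⟩
  have hx : (s ++ u :: t).formPerm u = x := by
    rw [List.formPerm_eq_of_isRotated hn hr]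
    simp
  rwa [hx]

/-- All neighbours of an endpoint of a longest path lie on the path, so a chord from that endpoint
closes a cycle. -/
theorem exists_isCycleList [Fintype V] [DecidableRel G.Adj] [Nonempty V]
    (h : 2 ≤ G.minDegree) : ∃ l, G.IsCycleList l := by
  classical
  obtain ⟨l, ⟨hn, hc, hne⟩, hmax⟩ := List.exists_nodup_maximal_length
    (fun l : List V => l.Nodup ∧ l.IsChain G.Adj ∧ l ≠ []) (fun l hl => hl.1)
    ⟨[Classical.arbitrary V], by simp⟩
  rcases l with _ | ⟨x, t⟩
  · exact absurd rfl hne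
  have hnb : ∀ y, G.Adj x y → y ∈ t := by
    intro y hy
    by_contra hyt
    have := hmax (y :: x :: t) ⟨?_, ?_, by simp⟩
    · simp at this
    · rw [List.nodup_cons]
      exact ⟨by simp [hyt, hy.ne'], hn⟩
    · exact List.isChain_cons_cons.2 ⟨hy.symm, hc⟩
  have hdeg : 1 < (G.neighborFinset x).card := by
    rw [card_neighborFinset_eq_degree]
    exact lt_of_lt_of_le (by omega) (G.minDegree_le_degree x)
  obtain ⟨y, hy, z, hz, hyz⟩ := Finset.one_lt_card.1 hdeg
  simp only [mem_neighborFinset] at hy hz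
  -- A neighbour other than the second vertex of the path makes the cycle have length at least 3.
  obtain ⟨y, hy, hyh⟩ : ∃ y, G.Adj x y ∧ t.head? ≠ some y := by
    by_cases hh : t.head? = some y
    · exact ⟨z, hz, by rw [hh]; simpa using hyz⟩
    · exact ⟨y, hy, hh⟩
  obtain ⟨t₁, t₂, rfl⟩ := List.append_of_mem (hnb y hy)
  rcases t₁ with _ | ⟨a, t₁⟩
  · simp at hyh
  have hl : x :: (a :: t₁ ++ y :: t₂) = (x :: a :: t₁ ++ [y]) ++ t₂ := by simp
  rw [hl] at hn hc
  refine ⟨x :: a :: t₁ ++ [y], by simp, hn.of_append_left, (List.isChain_append.1 hc).1, ?_⟩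
  intro p hp q hq
  simp [List.getLast?_cons] at hp hq
  subst hp hq; exact hy.symm

theorem IsCycleList.isHamiltonian [Fintype V] [DecidableEq V] {l : List V} (h : G.IsCycleList l)
    (hall : ∀ v, v ∈ l) : G.IsHamiltonian := by
  intro _
  obtain ⟨h1, h2, h3, h4⟩ := h
  rcases l with _ | ⟨x, t⟩
  · simp at h1
  have hc : (x :: t ++ [x]).IsChain G.Adj := by
    rw [List.isChain_append]
    refine ⟨h3, by simp, ?_⟩
    intro a ha b hb
    exact h4 a ha b (by simpa using hb)
  let p := Walk.ofSupport (x :: t ++ [x]) (by simp) hc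
  have hs : p.support = x :: t ++ [x] := Walk.support_ofSupport ..
  have hlen : p.length = (x :: t).length := by
    have := p.length_support
    rw [hs] at this
    simp at this ⊢; omega
  have hx : (x :: t ++ [x]).getLast (by simp) = x := by simp
  have hh : (x :: t ++ [x]).head (by simp) = x := by simp
  let q : G.Walk x x := p.copy hh hx
  have hqs : q.support = x :: t ++ [x] := by
    rw [Walk.support_copy, hs]
  have hql : q.length = (x :: t).length := by
    rw [Walk.length_copy, hlen]
  have hqn : ¬ q.Nil := by rw [← Walk.length_eq_zero_iff, hql]; simp
  refine ⟨x, q, Walk.isHamiltonianCycle_iff_isCycle_and_length_eq.2 ⟨?_, ?_⟩⟩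
  · rw [Walk.isCycle_iff_isPath_tail_and_le_length]
    refine ⟨?_, by rw [hql]; exact h1⟩
    rw [Walk.isPath_def, Walk.support_tail_of_not_nil _ hqn, hqs]
    exact List.nodup_append_comm.1 (by simpa using h2)
  · rw [hql]
    refine le_antisymm h2.length_le_card ?_
    rw [← List.toFinset_card_of_nodup h2]
    exact Finset.card_le_card fun v _ => by simpa using hall v

end SimpleGraph

/-! ### The Chvátal–Erdős separator -/

namespace SimpleGraph

variable {V : Type*} {G : SimpleGraph V}

theorem exists_nodup_chain_avoiding [DecidableEq V] {l : List V} {v a b : V}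
    (ha : ∃ p : G.Walk v a, ∀ y ∈ p.support, y ∉ l)
    (hb : ∃ p : G.Walk v b, ∀ y ∈ p.support, y ∉ l) :
    ∃ R : List V, R.IsChain G.Adj ∧ R.Nodup ∧ R.head? = some a ∧ R.getLast? = some b ∧
      ∀ y ∈ R, y ∉ l := by
  obtain ⟨p, hp⟩ := ha
  obtain ⟨q, hq⟩ := hb
  let w := (p.reverse.append q).bypass
  refine ⟨w.support, w.isChain_adj_support, (Walk.bypass_isPath _).support_nodup, ?_, ?_, ?_⟩
  · rw [List.head?_eq_some_head w.support_ne_nil, Walk.head_support]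
  · rw [List.getLast?_eq_some_getLast w.support_ne_nil, Walk.getLast_support]
  · intro y hy
    have := Walk.support_bypass_subset_support _ hy
    rw [Walk.mem_support_append_iff] at this
    rcases this with h | h
    · exact hp y (by simpa using h)
    · exact hq y h

/-- The structural half of the Chvátal–Erdős theorem. -/
theorem exists_separator_of_not_isHamiltonian [Fintype V] [DecidableEq V] [DecidableRel G.Adj]
    [Nonempty V] (h2 : 2 ≤ G.minDegree) (hG : ¬ G.IsHamiltonian) :
    ∃ A S I : Finset V, A.Nonempty ∧ Disjoint A S ∧ (∀ x ∈ A, ∀ y, G.Adj x y → y ∈ A ∪ S) ∧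
      (∃ b, b ∉ A ∪ S) ∧ (∀ x ∈ I, ∀ y ∈ I, ¬ G.Adj x y) ∧ I.card = S.card + 1 := by
  classical
  obtain ⟨l, hl, hmax⟩ := List.exists_nodup_maximal_length G.IsCycleList
    (fun l hl => hl.nodup) (exists_isCycleList h2)
  obtain ⟨v, hv⟩ : ∃ v, v ∉ l := by
    by_contra! hall
    exact hG (hl.isHamiltonian hall)
  have hl2 : 2 ≤ l.length := by have := hl.three_le_length; omega
  let A : Finset V := {x | ∃ p : G.Walk v x, ∀ y ∈ p.support, y ∉ l}
  let S : Finset V := {u | u ∈ l ∧ ∃ a ∈ A, G.Adj u a}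
  have hA : ∀ {x}, x ∈ A ↔ ∃ p : G.Walk v x, ∀ y ∈ p.support, y ∉ l := by simp [A]
  have hS : ∀ {u}, u ∈ S ↔ u ∈ l ∧ ∃ a ∈ A, G.Adj u a := by simp [S]
  have hvA : v ∈ A := hA.2 ⟨Walk.nil, by simpa using hv⟩
  have hAl : ∀ x ∈ A, x ∉ l := by
    intro x hx
    obtain ⟨p, hp⟩ := hA.1 hx
    exact hp x p.end_mem_support
  have hnbr : ∀ x ∈ A, ∀ y, G.Adj x y → y ∈ A ∪ S := by
    intro x hx y hxy
    rw [Finset.mem_union]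
    by_cases hy : y ∈ l
    · exact Or.inr (hS.2 ⟨hy, x, hx, hxy.symm⟩)
    · left
      obtain ⟨p, hp⟩ := hA.1 hx
      refine hA.2 ⟨p.concat hxy, ?_⟩
      intro z hz
      rw [Walk.support_concat] at hz
      simp only [List.mem_append, List.mem_singleton] at hz
      rcases hz with hz | rfl
      · exact hp z hz
      · exact hy
  -- A path through all the cycle's vertices whose two ends both have neighbours in `A` closes up
  -- through `A` into a longer cycle.
  have hlong : ∀ {x u : V} {m : List V} {a b : V}, (x :: m ++ [u]).Perm l →
      (x :: m ++ [u]).IsChain G.Adj → a ∈ A → b ∈ A → G.Adj u a → G.Adj x b → False := by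
    intro x u m a b hp hc ha hb hua hxb
    obtain ⟨R, hR1, hR2, hR3, hR4, hR5⟩ := exists_nodup_chain_avoiding (hA.1 ha) (hA.1 hb)
    have hcyc := isCycleList_append_path (hp.length_eq ▸ hl.three_le_length)
      (hp.nodup_iff.2 hl.nodup) hc hR1 hR2 hR3 hR4
      (fun y hy hyR => hR5 y hyR (hp.mem_iff.1 hy)) hua hxb.symm
    have := hmax _ hcyc
    rw [List.length_append, hp.length_eq] at this
    have hRne : R ≠ [] := by rintro rfl; simp at hR3
    have := List.length_pos_of_ne_nil hRne
    omega
  have hsucc : ∀ u ∈ S, ∀ b ∈ A, ¬ G.Adj (l.formPerm u) b := by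
    intro u hu b hb hub
    obtain ⟨hul, a, ha, hua⟩ := hS.1 hu
    obtain ⟨m, hm⟩ := exists_isRotated_formPerm hl.nodup hl2 hul
    exact hlong hm.perm.symm (hl.isRotated hm).isChain ha hb hua hub
  -- An edge between two successors is the chord for `cross`, which yields a path from `w` to `u`,
  -- both ends adjacent to `A`.
  have hcross : ∀ u ∈ S, ∀ w ∈ S, ¬ G.Adj (l.formPerm u) (l.formPerm w) := by
    intro u hu w hw hadj
    obtain ⟨hul, a, ha, hua⟩ := hS.1 hu
    obtain ⟨hwl, b, hb, hwb⟩ := hS.1 hw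
    have hne : w ≠ u := by rintro rfl; exact G.irrefl hadj
    obtain ⟨m, hm⟩ := exists_isRotated_formPerm hl.nodup hl2 hul
    have hwm : w ∈ l.formPerm u :: m := by
      have := hm.perm.mem_iff.1 hwl
      rw [List.mem_append] at this
      exact this.resolve_right (by simpa using hne)
    obtain ⟨P, Q, hPQ⟩ := List.append_of_mem hwm
    have hsplit : l.formPerm u :: m ++ [u] = (P ++ [w]) ++ (Q ++ [u]) := by rw [hPQ]; simp
    have hQ : (Q ++ [u]).head? = some (l.formPerm w) := by
      rcases hy : Q ++ [u] with _ | ⟨y, Q'⟩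
      · simp at hy
      have hr : l ~r (y :: (Q' ++ P) ++ [w]) := by
        refine hm.trans ?_
        rw [hsplit, hy]
        simpa using List.isRotated_append (l := P ++ [w]) (l' := y :: Q')
      rw [List.formPerm_eq_of_isRotated hl.nodup hr]
      have := List.formPerm_apply_getLast y (Q' ++ P ++ [w])
      simp only [List.cons_append] at this ⊢
      simpa using this.symm
    obtain ⟨m', hp, hc⟩ := (hl.isRotated hm).cross (w := w) hsplit (by simp) hQ hadj
    exact hlong (hp.symm.trans hm.perm.symm) hc ha hb hua hwb
  have hSl : ∀ u ∈ S, l.formPerm u ∈ l := fun u hu =>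
    List.formPerm_apply_mem_of_mem (hS.1 hu).1
  refine ⟨A, S, insert v (S.image l.formPerm), ⟨v, hvA⟩, ?_, hnbr, ?_, ?_, ?_⟩
  · rw [Finset.disjoint_left]
    exact fun x hx hxS => hAl x hx (hS.1 hxS).1
  -- A vertex beyond the separator: any cycle vertex if `S` is empty, otherwise the successor of a
  -- vertex of `S`.
  · rcases S.eq_empty_or_nonempty with h0 | ⟨u, hu⟩
    · obtain ⟨c, hc⟩ := List.exists_mem_of_length_pos (l := l) (by omega)
      exact ⟨c, by rw [h0, Finset.union_empty]; exact fun h => hAl c h hc⟩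
    · refine ⟨l.formPerm u, ?_⟩
      rw [Finset.mem_union, not_or]
      refine ⟨fun h => hAl _ h (hSl u hu), fun h => ?_⟩
      obtain ⟨-, b, hb, hub⟩ := hS.1 h
      exact hsucc u hu b hb hub
  · intro x hx y hy hxy
    rw [Finset.mem_insert, Finset.mem_image] at hx hy
    rcases hx with rfl | ⟨u, hu, rfl⟩ <;> rcases hy with rfl | ⟨w, hw, rfl⟩
    · exact G.irrefl hxy
    · exact hsucc w hw _ hvA hxy.symm
    · exact hsucc u hu _ hvA hxy
    · exact hcross u hu w hw hxy
  · rw [Finset.card_insert_of_notMem, Finset.card_image_of_injective _ l.formPerm.injective]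
    rw [Finset.mem_image]
    rintro ⟨u, hu, rfl⟩
    exact hv (hSl u hu)

end SimpleGraph

/-! ### Laplacian spectrum and edge counts -/

namespace SimpleGraph

open Matrix Finset

section Spectral

variable {V : Type*} [Fintype V] [DecidableEq V]

theorem _root_.Matrix.IsHermitian.sum_eigenvalues_mul_dotProduct {M : Matrix V V ℝ}
    (hM : M.IsHermitian) (x : V → ℝ) :
    x ⬝ᵥ (M *ᵥ x) =
      ∑ i, hM.eigenvalues i * ((hM.eigenvectorBasis i : V → ℝ) ⬝ᵥ x) ^ 2 := by
  have h := hM.eigenvectorBasis.sum_inner_mul_inner (WithLp.toLp 2 x) (WithLp.toLp 2 (M *ᵥ x))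
  simp only [EuclideanSpace.inner_eq_star_dotProduct, star_trivial] at h
  rw [dotProduct_comm, ← h]
  refine Finset.sum_congr rfl fun i _ => ?_
  have h2 : (M *ᵥ x) ⬝ᵥ (hM.eigenvectorBasis i : V → ℝ) =
      hM.eigenvalues i * ((hM.eigenvectorBasis i : V → ℝ) ⬝ᵥ x) := by
    rw [dotProduct_comm, dotProduct_mulVec, ← mulVec_transpose]
    have : Mᵀ = M := by simpa [IsHermitian, conjTranspose_eq_transpose_of_trivial] using hM
    rw [this, hM.mulVec_eigenvectorBasis, smul_dotProduct, smul_eq_mul]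
  rw [h2]
  ring

theorem _root_.Matrix.IsHermitian.sum_dotProduct_mul_dotProduct {M : Matrix V V ℝ}
    (hM : M.IsHermitian) (x y : V → ℝ) :
    x ⬝ᵥ y = ∑ i, ((hM.eigenvectorBasis i : V → ℝ) ⬝ᵥ x) *
      ((hM.eigenvectorBasis i : V → ℝ) ⬝ᵥ y) := by
  have h := hM.eigenvectorBasis.sum_inner_mul_inner (WithLp.toLp 2 x) (WithLp.toLp 2 y)
  simp only [EuclideanSpace.inner_eq_star_dotProduct, star_trivial] at h
  rw [dotProduct_comm x y, ← h]
  refine Finset.sum_congr rfl fun i _ => ?_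
  rw [dotProduct_comm y]

variable (G : SimpleGraph V) [DecidableRel G.Adj]

theorem exists_forall_ne_abs_sub_eigenvalues_le {d θ : ℝ} [Nonempty V]
    (hσ : ∀ i : Fin (Fintype.card V), (i : ℕ) ≠ 0 → |d - G.lapEigenvalue i| ≤ θ) :
    ∃ i₀, ∀ i, i ≠ i₀ → |d - (G.isHermitian_lapMatrix ℝ).eigenvalues i| ≤ θ := by
  have hpos : 0 < Fintype.card V := Fintype.card_pos
  let e : Fin (Fintype.card V) ≃ V := Fintype.equivOfCardEq (Fintype.card_fin _)
  refine ⟨e (Fin.rev ⟨0, hpos⟩), fun i hi => ?_⟩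
  -- `eigenvalues` follows the decreasing order, so the exempt smallest eigenvalue is the last one.
  have h := hσ (Fin.rev (e.symm i)) ?_
  · simpa [lapEigenvalue, IsHermitian.eigenvalues, e] using h
  · intro h0
    apply hi
    rw [← Equiv.symm_apply_eq, ← Fin.rev_rev (e.symm i)]
    congr 1
    exact Fin.ext h0

/-- Since `θ < d`, every eigenvalue but one is positive. The constant vector lies in the kernel,
hence spans the exceptional eigenline, and a vector of sum zero has no component there. -/
theorem abs_dotProduct_lapMatrix_sub_le_of_sum_eq_zero {d θ : ℝ} [Nonempty V] (hθ : θ < d)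
    (hσ : ∀ i : Fin (Fintype.card V), (i : ℕ) ≠ 0 → |d - G.lapEigenvalue i| ≤ θ)
    {x : V → ℝ} (hx : ∑ v, x v = 0) :
    |x ⬝ᵥ (G.lapMatrix ℝ *ᵥ x) - d * (x ⬝ᵥ x)| ≤ θ * (x ⬝ᵥ x) := by
  obtain ⟨i₀, hi₀⟩ := G.exists_forall_ne_abs_sub_eigenvalues_le hσ
  set hM := G.isHermitian_lapMatrix ℝ
  set c : (V → ℝ) → V → ℝ := fun y i => (hM.eigenvectorBasis i : V → ℝ) ⬝ᵥ y
  have hone : ∀ i, i ≠ i₀ → c 1 i = 0 := by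
    intro i hi
    have h0 : (1 : V → ℝ) ⬝ᵥ (G.lapMatrix ℝ *ᵥ 1) = 0 := by
      rw [show (1 : V → ℝ) = fun _ => 1 from rfl, G.lapMatrix_mulVec_const_eq_zero]; simp
    rw [hM.sum_eigenvalues_mul_dotProduct] at h0
    have hnn : ∀ i ∈ Finset.univ, 0 ≤ hM.eigenvalues i * (c 1 i) ^ 2 := fun i _ =>
      mul_nonneg ((G.posSemidef_lapMatrix ℝ).eigenvalues_nonneg i) (sq_nonneg _)
    have h1 := (Finset.sum_eq_zero_iff_of_nonneg hnn).1 h0 i (Finset.mem_univ i)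
    have h2 := abs_le.1 (hi₀ i hi)
    have h3 : 0 < hM.eigenvalues i := by linarith
    simpa [h3.ne'] using h1
  have hx0 : c x i₀ = 0 := by
    have h1 := hM.sum_dotProduct_mul_dotProduct x 1
    rw [dotProduct_one, hx, Finset.sum_eq_single i₀ (fun i _ hi => by
      rw [show (hM.eigenvectorBasis i : V → ℝ) ⬝ᵥ 1 = 0 from hone i hi, mul_zero]) (by simp)] at h1
    have h2 := hM.sum_dotProduct_mul_dotProduct (1 : V → ℝ) 1
    rw [Finset.sum_eq_single i₀ (fun i _ hi => by
      rw [show (hM.eigenvectorBasis i : V → ℝ) ⬝ᵥ 1 = 0 from hone i hi, mul_zero]) (by simp)] at h2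
    have h3 : (hM.eigenvectorBasis i₀ : V → ℝ) ⬝ᵥ 1 ≠ 0 := by
      intro h
      rw [h, mul_zero, dotProduct_one] at h2
      simp at h2
    exact (mul_eq_zero.1 h1.symm).resolve_right h3
  rw [hM.sum_eigenvalues_mul_dotProduct, hM.sum_dotProduct_mul_dotProduct x x, Finset.mul_sum,
    Finset.mul_sum, ← Finset.sum_sub_distrib]
  refine (Finset.abs_sum_le_sum_abs _ _).trans (Finset.sum_le_sum fun i _ => ?_)
  change |hM.eigenvalues i * (c x i) ^ 2 - d * (c x i * c x i)| ≤ θ * (c x i * c x i)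
  by_cases hi : i = i₀
  · rw [hi, hx0]; simp
  · have : hM.eigenvalues i * (c x i) ^ 2 - d * (c x i * c x i) =
        -(d - hM.eigenvalues i) * (c x i * c x i) := by ring
    rw [this, abs_mul, abs_neg, abs_mul_self]
    exact mul_le_mul_of_nonneg_right (hi₀ i hi) (mul_self_nonneg _)

theorem abs_dotProduct_lapMatrix_sub_le {d θ : ℝ} [Nonempty V] (hθ : θ < d)
    (hσ : ∀ i : Fin (Fintype.card V), (i : ℕ) ≠ 0 → |d - G.lapEigenvalue i| ≤ θ) (f : V → ℝ) :
    |f ⬝ᵥ (G.lapMatrix ℝ *ᵥ f) - d * (f ⬝ᵥ f - (∑ v, f v) ^ 2 / Fintype.card V)| ≤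
      θ * (f ⬝ᵥ f - (∑ v, f v) ^ 2 / Fintype.card V) := by
  have hn : (Fintype.card V : ℝ) ≠ 0 := by simp
  set m : ℝ := (∑ v, f v) / Fintype.card V with hm
  have h1 : G.lapMatrix ℝ *ᵥ (fun _ => m) = 0 := by
    rw [lapMatrix_mulVec_eq_zero_iff_forall_adj]; simp
  have h2 : ∀ y : V → ℝ, (fun _ => m) ⬝ᵥ (G.lapMatrix ℝ *ᵥ y) = 0 := by
    intro y
    rw [dotProduct_mulVec, ← mulVec_transpose, (G.isSymm_lapMatrix (R := ℝ)), h1, zero_dotProduct]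
  have h3 := G.abs_dotProduct_lapMatrix_sub_le_of_sum_eq_zero hθ hσ (x := f - fun _ => m) (by
    simp [hm]; field_simp; simp)
  have h4 : (f - fun _ => m) ⬝ᵥ (f - fun _ => m) = f ⬝ᵥ f - (∑ v, f v) ^ 2 / Fintype.card V := by
    have h5 : f ⬝ᵥ (fun _ => m) = (∑ v, f v) * m := by simp [dotProduct, Finset.sum_mul]
    have h6 : (fun _ : V => m) ⬝ᵥ (fun _ => m) = Fintype.card V * (m * m) := by simp [dotProduct]
    rw [dotProduct_sub, sub_dotProduct, sub_dotProduct, dotProduct_comm (fun _ => m) f, h5, h6, hm]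
    field_simp
    ring
  rw [mulVec_sub, h1, sub_zero, sub_dotProduct, h2, sub_zero, h4] at h3
  exact h3

/-- Polarisation: compare the quadratic bound at `f + g` and at `f - g`. -/
theorem abs_dotProduct_lapMatrix_sub_le_add {d θ : ℝ} [Nonempty V] (hθ : θ < d)
    (hσ : ∀ i : Fin (Fintype.card V), (i : ℕ) ≠ 0 → |d - G.lapEigenvalue i| ≤ θ) (f g : V → ℝ) :
    |f ⬝ᵥ (G.lapMatrix ℝ *ᵥ g) - d * (f ⬝ᵥ g - (∑ v, f v) * (∑ v, g v) / Fintype.card V)| ≤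
      θ / 2 * ((f ⬝ᵥ f - (∑ v, f v) ^ 2 / Fintype.card V) +
        (g ⬝ᵥ g - (∑ v, g v) ^ 2 / Fintype.card V)) := by
  have h1 := G.abs_dotProduct_lapMatrix_sub_le hθ hσ (f + g)
  have h2 := G.abs_dotProduct_lapMatrix_sub_le hθ hσ (f - g)
  have hsymm : g ⬝ᵥ (G.lapMatrix ℝ *ᵥ f) = f ⬝ᵥ (G.lapMatrix ℝ *ᵥ g) := by
    rw [dotProduct_mulVec, ← mulVec_transpose, (G.isSymm_lapMatrix (R := ℝ)), dotProduct_comm]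
  simp only [mulVec_add, mulVec_sub, dotProduct_add, add_dotProduct, dotProduct_sub,
    sub_dotProduct, Pi.add_apply, Pi.sub_apply, Finset.sum_add_distrib, Finset.sum_sub_distrib,
    hsymm, dotProduct_comm g f, add_sq, sub_sq, add_div, sub_div] at h1 h2
  rw [abs_le] at h1 h2 ⊢
  constructor <;> ring_nf at h1 h2 ⊢ <;> linarith [h1.1, h1.2, h2.1, h2.2]

/-- The number of ordered pairs `(v, w) ∈ A × S` of adjacent vertices, as a real number. -/
noncomputable def edgesBetween (A S : Finset V) : ℝ :=
  ∑ v ∈ A, ∑ w ∈ S, G.adjMatrix ℝ v w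

variable {G}

/-- A form of the expander mixing lemma for the Laplacian. -/
theorem abs_edgesBetween_sub_le {d θ : ℝ} [Nonempty V] (hθ : θ < d)
    (hσ : ∀ i : Fin (Fintype.card V), (i : ℕ) ≠ 0 → |d - G.lapEigenvalue i| ≤ θ)
    {A S : Finset V} (hAS : Disjoint A S) {r n : ℝ} (hr : 0 < r) (hn : n = Fintype.card V) :
    |G.edgesBetween A S - d * (#A * #S / n)| ≤
      θ / 2 * (r * (#A * (n - #A) / n) + #S * (n - #S) / n / r) := by
  have hn0 : n ≠ 0 := by rw [hn]; simp
  -- The free scale `r` allows the two error terms to be balanced later, in place of a geometric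
  -- mean.
  let f : V → ℝ := fun v => if v ∈ A then r else 0
  let g : V → ℝ := fun v => if v ∈ S then 1 else 0
  have h := G.abs_dotProduct_lapMatrix_sub_le_add hθ hσ f g
  have hff : f ⬝ᵥ f = r ^ 2 * #A := by simp [f, dotProduct]; ring
  have hgg : g ⬝ᵥ g = #S := by simp [g, dotProduct]
  have hfg : f ⬝ᵥ g = 0 := by
    refine Finset.sum_eq_zero fun v _ => ?_
    by_cases hv : v ∈ A
    · simp [g, Finset.disjoint_left.1 hAS hv]
    · simp [f, hv]
  have hf : ∑ v, f v = r * #A := by simp [f]; ring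
  have hg : ∑ v, g v = #S := by simp [g]
  have hL : f ⬝ᵥ (G.lapMatrix ℝ *ᵥ g) = - (r * G.edgesBetween A S) := by
    rw [lapMatrix, sub_mulVec, dotProduct_sub]
    have h1 : f ⬝ᵥ (G.degMatrix ℝ *ᵥ g) = 0 := by
      refine Finset.sum_eq_zero fun v _ => ?_
      rw [degMatrix_mulVec_apply]
      by_cases hv : v ∈ A
      · simp [g, Finset.disjoint_left.1 hAS hv]
      · simp [f, hv]
    have h2 : f ⬝ᵥ (G.adjMatrix ℝ *ᵥ g) = r * G.edgesBetween A S := by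
      simp only [f, g, edgesBetween, dotProduct, mulVec, mul_ite, mul_one, mul_zero, ite_mul,
        zero_mul, Finset.sum_ite_mem, Finset.univ_inter, Finset.mul_sum]
      rw [← Finset.univ_inter A, ← Finset.sum_ite_mem, Finset.univ_inter]
      refine Finset.sum_congr rfl fun v _ => ?_
      split_ifs <;> simp
    rw [h1, h2, zero_sub]
  rw [hL, hff, hgg, hfg, hf, hg, ← hn] at h
  have e1 : -(r * G.edgesBetween A S) - d * (0 - r * #A * #S / n) =
      -(r * (G.edgesBetween A S - d * (#A * #S / n))) := by ring
  rw [e1, abs_neg, abs_mul, abs_of_pos hr] at h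
  have e2 : θ / 2 * (r ^ 2 * #A - (r * #A) ^ 2 / n + (#S - (#S : ℝ) ^ 2 / n)) =
      r * (θ / 2 * (r * (#A * (n - #A) / n) + #S * (n - #S) / n / r)) := by
    field_simp
  rw [e2] at h
  exact le_of_mul_le_mul_left h hr

theorem edgesBetween_compl_of_indep {I : Finset V} (hI : ∀ x ∈ I, ∀ y ∈ I, ¬ G.Adj x y) :
    G.edgesBetween I Iᶜ = ∑ v ∈ I, (G.degree v : ℝ) := by
  refine Finset.sum_congr rfl fun v hv => ?_
  have h0 : ∑ w ∈ I, G.adjMatrix ℝ v w = 0 :=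
    Finset.sum_eq_zero fun w hw => by simp [hI v hv w hw]
  have := Finset.sum_add_sum_compl I (fun w => G.adjMatrix ℝ v w)
  rw [h0, zero_add] at this
  rw [this]
  simp [adjMatrix_apply, degree_eq_sum_if_adj]

/-- All edges at an independent set go to its complement. Singletons give bounds on individual
degrees. -/
theorem abs_sum_degree_sub_le {d θ : ℝ} [Nonempty V] (hθ : θ < d)
    (hσ : ∀ i : Fin (Fintype.card V), (i : ℕ) ≠ 0 → |d - G.lapEigenvalue i| ≤ θ)
    {I : Finset V} (hI : ∀ x ∈ I, ∀ y ∈ I, ¬ G.Adj x y) {n : ℝ} (hn : n = Fintype.card V) :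
    |∑ v ∈ I, (G.degree v : ℝ) - d * (#I * (n - #I) / n)| ≤ θ * (#I * (n - #I) / n) := by
  have h := abs_edgesBetween_sub_le hθ hσ (disjoint_compl_right (a := I)) one_pos hn
  rw [edgesBetween_compl_of_indep hI, Finset.card_compl,
    Nat.cast_sub (Finset.card_le_univ I), ← hn] at h
  convert h using 1
  ring

end Spectral

end SimpleGraph

/-! ### Impossibility of a small separator -/

namespace SimpleGraph

open Finset

variable {V : Type*} [Fintype V] [DecidableEq V] {G : SimpleGraph V} [DecidableRel G.Adj]

/-- The numerical incompatibility of the edge-count estimates for a small separator. -/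
theorem false_of_separator_bounds {d θ δ n a b s e : ℝ} (hδ0 : 0 < δ) (hδd : δ ≤ d) (hθ0 : 0 < θ)
    (hθδ : 5 * θ ≤ δ) (ha : 0 < a) (hle : a ≤ b) (hs : 0 ≤ s) (hcard : a + b + s = n)
    (hdeg : δ ≤ a + s) (hS1 : (d + θ) * s ≤ 2 * n * θ) (hS2 : s + 25 * (θ ^ 2 / δ) ≤ δ)
    (h1 : -(θ / 2 * (1 * (a * (n - a) / n) + b * (n - b) / n / 1)) ≤ 0 - d * (a * b / n))
    (h2 : -(θ / 2 * (1 * (a * (n - a) / n) + (n - a) * (n - (n - a)) / n / 1)) ≤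
      e - d * (a * (n - a) / n))
    (h3 : e - d * (a * s / n) ≤
      θ / 2 * (δ / (5 * θ) * (a * (n - a) / n) + s * (n - s) / n / (δ / (5 * θ)))) : False := by
  have hd0 : 0 < d := by linarith
  have hn0 : 0 < n := by linarith
  have hδa : 25 * θ ^ 2 ≤ δ * a := by
    -- A vertex of `A` has all its neighbours in `A ∪ S`, so `a ≥ δ - s`.
    have : 25 * (θ ^ 2 / δ) ≤ a := by linarith
    calc 25 * θ ^ 2 = δ * (25 * (θ ^ 2 / δ)) := by field_simp
      _ ≤ δ * a := mul_le_mul_of_nonneg_left this hδ0.le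
  have hsδ : s ≤ δ := by
    have : 0 ≤ 25 * (θ ^ 2 / δ) := by positivity
    linarith
  have hs3 : 3 * s ≤ n := by
    have h4 : (d + θ) * (3 * s) ≤ (d + θ) * n := by nlinarith
    exact le_of_mul_le_mul_left h4 (by linarith)
  have hab : 20 * (a * b) ≤ n ^ 2 := by
    have h4 : d * (a * b) ≤ θ / 2 * (a * (n - a) + b * (n - b)) := by
      have : d * (a * b / n) ≤ θ / 2 * (1 * (a * (n - a) / n) + b * (n - b) / n / 1) := by linarith
      have := mul_le_mul_of_nonneg_left this hn0.le
      calc d * (a * b) = n * (d * (a * b / n)) := by field_simp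
        _ ≤ _ := this
        _ = _ := by field_simp
    have h5 : a * (n - a) + b * (n - b) ≤ n ^ 2 / 2 := by
      nlinarith [sq_nonneg (n - 2 * a), sq_nonneg (n - 2 * b)]
    have h6 : θ / 2 * (a * (n - a) + b * (n - b)) ≤ θ / 2 * (n ^ 2 / 2) :=
      mul_le_mul_of_nonneg_left h5 (by linarith)
    have h7 : d * (20 * (a * b)) ≤ d * n ^ 2 := by nlinarith [sq_nonneg n]
    exact le_of_mul_le_mul_left h7 hd0
  -- Lower and upper estimates for the edges leaving `A`, divided by `a / n`; each of the two upper
  -- error terms is at most `δa/10`.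
  have hkey : (d - θ) * (n - a) ≤ d * s + d * n / 5 := by
    have h4 : θ / 2 * (δ / (5 * θ) * (a * (n - a) / n)) ≤ δ * a / 10 := by
      have : a * (n - a) / n ≤ a := by
        rw [div_le_iff₀ hn0]; nlinarith
      calc θ / 2 * (δ / (5 * θ) * (a * (n - a) / n)) = δ / 10 * (a * (n - a) / n) := by
            field_simp; ring
        _ ≤ δ / 10 * a := mul_le_mul_of_nonneg_left this (by linarith)
        _ = _ := by ring
    have h5 : θ / 2 * (s * (n - s) / n / (δ / (5 * θ))) ≤ δ * a / 10 := by
      have h6 : s * (n - s) / n ≤ δ := by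
        rw [div_le_iff₀ hn0]; nlinarith
      calc θ / 2 * (s * (n - s) / n / (δ / (5 * θ)))
          = (5 / 2 * θ ^ 2 / δ) * (s * (n - s) / n) := by field_simp
        _ ≤ (5 / 2 * θ ^ 2 / δ) * δ := mul_le_mul_of_nonneg_left h6 (by positivity)
        _ = 5 / 2 * θ ^ 2 := by field_simp
        _ ≤ _ := by linarith
    have h7 : (d - θ) * (a * (n - a) / n) ≤ d * (a * s / n) + d * a / 5 := by
      have h8 : a * (n - a) / n = 1 * (a * (n - a) / n) := by ring
      have h9 : (n - a) * (n - (n - a)) / n / 1 = a * (n - a) / n := by ring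
      rw [h9] at h2
      have h10 : δ * a ≤ d * a := mul_le_mul_of_nonneg_right hδd ha.le
      rw [mul_add] at h3
      linarith
    have h8 := mul_le_mul_of_nonneg_left h7 (show 0 ≤ n / a by positivity)
    calc (d - θ) * (n - a) = n / a * ((d - θ) * (a * (n - a) / n)) := by field_simp
      _ ≤ _ := h8
      _ = _ := by field_simp
  -- Uses `θ ≤ d/5` and `s ≤ n/3`.
  have ha3 : n ≤ 3 * a := by
    have h4 : d * (4 / 5 * (n - a)) ≤ d * (s + n / 5) := by nlinarith
    have h5 := le_of_mul_le_mul_left h4 hd0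
    linarith
  have h4 : a * a ≤ a * b := mul_le_mul_of_nonneg_left hle ha.le
  have h5 : n * n ≤ 3 * a * (3 * a) := mul_self_le_mul_self hn0.le ha3
  have h6 : 0 < a * a := mul_pos ha ha
  nlinarith

/-- Under the spectral hypothesis, two nonadjacent vertex sets cannot be separated by a set that is
small compared with both the minimum degree and the Hoffman-type bound on independent sets. -/
theorem false_of_small_separator {d θ δ n : ℝ} [Nonempty V] (hn : n = Fintype.card V)
    (hδ : ∀ v, δ ≤ G.degree v) (hδd : δ ≤ d) (hθ0 : 0 < θ) (hθδ : 5 * θ ≤ δ)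
    (hσ : ∀ i : Fin (Fintype.card V), (i : ℕ) ≠ 0 → |d - G.lapEigenvalue i| ≤ θ)
    {A B S : Finset V} (hA : A.Nonempty) (hAB : Disjoint A B) (hAS : Disjoint A S)
    (hBS : Disjoint B S) (hcover : A ∪ B ∪ S = univ) (hadj : ∀ x ∈ A, ∀ y ∈ B, ¬ G.Adj x y)
    (hle : #A ≤ #B) (hS1 : (d + θ) * #S ≤ 2 * n * θ) (hS2 : #S + 25 * (θ ^ 2 / δ) ≤ δ) :
    False := by
  have hθd : θ < d := by linarith
  have hδ0 : 0 < δ := by linarith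
  have hd0 : 0 < d := by linarith
  have hcard : (#A + #B + #S : ℝ) = n := by
    have hABS : Disjoint (A ∪ B) S := disjoint_union_left.2 ⟨hAS, hBS⟩
    have := card_union_of_disjoint hABS
    rw [card_union_of_disjoint hAB, hcover, card_univ] at this
    rw [hn, this]; push_cast; ring
  have ha : (0 : ℝ) < #A := by exact_mod_cast hA.card_pos
  have hle' : (#A : ℝ) ≤ #B := by exact_mod_cast hle
  have hs : (0 : ℝ) ≤ #S := by positivity
  have hn0 : 0 < n := by linarith
  have hAB0 : G.edgesBetween A B = 0 :=
    sum_eq_zero fun v hv => sum_eq_zero fun w hw => by simp [hadj v hv w hw]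
  have hABc : G.edgesBetween A Aᶜ = G.edgesBetween A S := by
    have hc : Aᶜ = B ∪ S := by
      ext x
      have hx : x ∈ A ∪ B ∪ S := by rw [hcover]; exact mem_univ x
      have h1 := fun h : x ∈ A => Finset.disjoint_left.1 hAB h
      have h2 := fun h : x ∈ A => Finset.disjoint_left.1 hAS h
      simp only [mem_union, mem_compl] at hx ⊢
      tauto
    have : G.edgesBetween A Aᶜ = G.edgesBetween A B + G.edgesBetween A S := by
      rw [hc]
      simp only [edgesBetween, sum_union hBS, sum_add_distrib]
    rw [this, hAB0, zero_add]
  have hdeg : δ ≤ #A + #S := by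
    obtain ⟨v, hv⟩ := hA
    refine (hδ v).trans ?_
    have hsub : G.neighborFinset v ⊆ A ∪ S := by
      intro w hw
      have hx : w ∈ A ∪ B ∪ S := by rw [hcover]; exact mem_univ w
      rw [mem_neighborFinset] at hw
      have := fun h => hadj v hv w h hw
      simp only [mem_union] at hx ⊢
      tauto
    have := (card_le_card hsub).trans (card_union_le A S)
    rw [card_neighborFinset_eq_degree] at this
    exact_mod_cast this
  have h1 := abs_edgesBetween_sub_le hθd hσ hAB one_pos hn
  have h2 := abs_edgesBetween_sub_le hθd hσ (disjoint_compl_right (a := A)) one_pos hn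
  -- This `r` turns the error term of `A` into at most `δ·#A/10`; the term of `S` is then at most
  -- `5θ²/2`, which `25θ² ≤ δ·#A` bounds by the same amount.
  have h3 := abs_edgesBetween_sub_le hθd hσ hAS (r := δ / (5 * θ)) (by positivity) hn
  rw [hAB0] at h1
  rw [hABc, card_compl, Nat.cast_sub (card_le_univ A), ← hn] at h2
  replace h1 := (abs_le.1 h1).1
  replace h2 := (abs_le.1 h2).1
  replace h3 := (abs_le.1 h3).2
  exact false_of_separator_bounds hδ0 hδd hθ0 hθδ ha hle' hs hcard hdeg hS1 hS2 h1 h2 h3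

theorem false_of_separator {d θ δ n : ℝ} [Nonempty V] (hn : n = Fintype.card V)
    (hδ : ∀ v, δ ≤ G.degree v) (hδd : δ ≤ d) (hθ0 : 0 < θ) (hθδ : 5 * θ ≤ δ)
    (hσ : ∀ i : Fin (Fintype.card V), (i : ℕ) ≠ 0 → |d - G.lapEigenvalue i| ≤ θ)
    {A S : Finset V} (hA : A.Nonempty) (hAS : Disjoint A S)
    (hadj : ∀ x ∈ A, ∀ y, G.Adj x y → y ∈ A ∪ S) (hne : ∃ b, b ∉ A ∪ S)
    (hS1 : (d + θ) * #S ≤ 2 * n * θ) (hS2 : #S + 25 * (θ ^ 2 / δ) ≤ δ) : False := by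
  obtain ⟨b, hb⟩ := hne
  set B := (A ∪ S)ᶜ with hB
  have hBne : B.Nonempty := ⟨b, by simpa [hB] using hb⟩
  have hdis : Disjoint (A ∪ S) B := disjoint_compl_right
  have hAB : Disjoint A B := (disjoint_union_left.1 hdis).1
  have hSB : Disjoint S B := (disjoint_union_left.1 hdis).2
  have hcover : A ∪ B ∪ S = univ := by
    rw [union_right_comm, hB, union_compl]
  have hadj' : ∀ x ∈ A, ∀ y ∈ B, ¬ G.Adj x y := fun x hx y hy h =>
    Finset.disjoint_left.1 hdis (hadj x hx y h) hy
  rcases le_total #A #B with h | h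
  · exact false_of_small_separator hn hδ hδd hθ0 hθδ hσ hA hAB hAS hSB.symm hcover hadj' h hS1 hS2
  · exact false_of_small_separator hn hδ hδd hθ0 hθδ hσ hBne hAB.symm hSB.symm hAS
      (by rw [union_comm B A, hcover]) (fun x hx y hy h' => hadj' y hy x hx h'.symm) h hS1 hS2

end SimpleGraph

/-! ### Assembly of the two halves -/

open SimpleGraph Finset in
theorem theorem3p3 {V : Type*} [Fintype V] [DecidableEq V] (G : SimpleGraph V)
    [DecidableRel G.Adj] (hδ : 0 < G.minDegree) (θ : ℝ)
    (hσ : ∀ i : Fin (Fintype.card V), (i : ℕ) ≠ 0 → |G.avgDegree - G.lapEigenvalue i| ≤ θ)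
    (h : (G.minDegree : ℝ) - (2 + 2 * Real.sqrt 3) ^ 2 * (θ ^ 2 / (G.minDegree : ℝ)) ≥
      (2 * (Fintype.card V : ℝ) * θ + G.avgDegree) / (G.avgDegree + θ)) :
    G.IsHamiltonian := by
  have hne : Nonempty V := by
    by_contra hV
    rw [not_nonempty_iff] at hV
    simp at hδ
  have hδv : ∀ v, (G.minDegree : ℝ) ≤ G.degree v := fun v => by
    exact_mod_cast G.minDegree_le_degree v
  have hcard : 1 < Fintype.card V := by
    obtain ⟨v⟩ := hne
    exact lt_of_le_of_lt (hδ.trans_le (G.minDegree_le_degree v)) (G.degree_lt_card_verts v)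
  have hθ0 : 0 ≤ θ := (abs_nonneg _).trans (hσ ⟨1, hcard⟩ (by simp))
  set d := G.avgDegree with hd
  set δ : ℝ := (G.minDegree : ℝ) with hδdef
  obtain ⟨n, hn⟩ : ∃ n : ℝ, n = Fintype.card V := ⟨_, rfl⟩
  rw [← hn] at h
  have hn1 : 1 < n := by rw [hn]; exact_mod_cast hcard
  have hn0 : 0 < n := by linarith
  have hδ0 : 0 < δ := by rw [hδdef]; exact_mod_cast hδ
  have hsum : ∑ v, (G.degree v : ℝ) = d * n := by
    rw [hd, avgDegree, ← hn]; field_simp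
  have hδd : δ ≤ d := by
    have h1 : ∑ _v : V, δ ≤ ∑ v, (G.degree v : ℝ) := Finset.sum_le_sum fun v _ => hδv v
    rw [hsum, Finset.sum_const, Finset.card_univ, nsmul_eq_mul, ← hn, mul_comm] at h1
    exact le_of_mul_le_mul_right h1 hn0
  have hdθ : 0 < d + θ := by linarith
  -- Only `2 + 2√3 ≥ 5` is needed; the square 25 yields `5θ ≤ δ`.
  have hK : 25 ≤ (2 + 2 * Real.sqrt 3) ^ 2 := by
    have : (3 / 2 : ℝ) ≤ Real.sqrt 3 := Real.le_sqrt_of_sq_le (by norm_num)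
    nlinarith
  set R := (2 * n * θ + d) / (d + θ) with hR
  have hRpos : 0 < R := div_pos (by nlinarith) hdθ
  have h25 : R + 25 * (θ ^ 2 / δ) ≤ δ := by
    have : 25 * (θ ^ 2 / δ) ≤ (2 + 2 * Real.sqrt 3) ^ 2 * (θ ^ 2 / δ) :=
      mul_le_mul_of_nonneg_right hK (by positivity)
    linarith
  have hθδ : 5 * θ ≤ δ := by
    have h1 : 25 * (θ ^ 2 / δ) ≤ δ := by linarith
    have h2 : 25 * (θ ^ 2 / δ) * δ ≤ δ * δ := mul_le_mul_of_nonneg_right h1 hδ0.le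
    have h3 : 25 * (θ ^ 2 / δ) * δ = 25 * θ ^ 2 := by field_simp
    exact abs_le_of_sq_le_sq' (by nlinarith) hδ0.le |>.2
  have hθd : θ < d := by linarith
  have hsingle : ∀ v, |(G.degree v : ℝ) - d * ((n - 1) / n)| ≤ θ * ((n - 1) / n) := by
    intro v
    have := abs_sum_degree_sub_le hθd hσ (I := {v}) (by simp) hn
    simpa using this
  have hδlow : (d - θ) * (n - 1) ≤ δ * n := by
    obtain ⟨v, hv⟩ := G.exists_minimal_degree_vertex
    have h1 := (abs_le.1 (hsingle v)).1
    rw [← hv, ← hδdef] at h1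
    have h2 : (d - θ) * ((n - 1) / n) ≤ δ := by linarith
    rwa [← mul_div_assoc, div_le_iff₀ hn0] at h2
  -- Averaging the upper degree bounds gives `dn ≤ (d + θ)(n - 1)`, which excludes `θ = 0` and later
  -- gives `R ≥ 2`.
  have hθlow : d ≤ θ * (n - 1) := by
    have h1 : ∑ v, (G.degree v : ℝ) ≤ ∑ _v : V, (d + θ) * ((n - 1) / n) :=
      Finset.sum_le_sum fun v _ => by linarith [(abs_le.1 (hsingle v)).2]
    rw [hsum, Finset.sum_const, Finset.card_univ, nsmul_eq_mul, ← hn] at h1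
    have h2 : n * ((d + θ) * ((n - 1) / n)) = (d + θ) * (n - 1) := by field_simp
    rw [h2] at h1
    linarith
  have hθpos : 0 < θ := by
    rcases hθ0.eq_or_lt with h0 | h0
    · rw [← h0] at hθlow; linarith
    · exact h0
  have hR2 : 2 ≤ R := by
    rw [hR, le_div_iff₀ hdθ]; linarith
  have hδ2 : 2 ≤ G.minDegree := by
    have : (2 : ℝ) ≤ δ := by
      have : 0 ≤ 25 * (θ ^ 2 / δ) := by positivity
      linarith
    rw [hδdef] at this
    exact_mod_cast this
  by_contra hham
  obtain ⟨A, S, I, hA, hAS, hadj, hb, hI, hIc⟩ := exists_separator_of_not_isHamiltonian hδ2 hham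
  -- The mixing bound gives `δn ≤ (d + θ)(n - |I|)`; combine with `δn ≥ (d - θ)(n - 1)`. The surplus
  -- `d - θ` is absorbed by `|I| = |S| + 1`.
  have hIle : (d + θ) * (#I : ℝ) ≤ 2 * n * θ + d - θ := by
    have hIpos : (0 : ℝ) < #I := by rw [hIc]; positivity
    have h1 := (abs_le.1 (abs_sum_degree_sub_le hθd hσ hI hn)).2
    have h2 : δ * #I ≤ ∑ v ∈ I, (G.degree v : ℝ) := by
      rw [mul_comm, ← nsmul_eq_mul]
      exact Finset.card_nsmul_le_sum _ _ _ fun v _ => hδv v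
    have h3 : δ * #I ≤ (d + θ) * (#I * (n - #I) / n) := by linarith
    have h4 := mul_le_mul_of_nonneg_left h3 (show 0 ≤ n / #I by positivity)
    have h5 : n / #I * (δ * #I) = δ * n := by field_simp
    have h6 : n / #I * ((d + θ) * (#I * (n - #I) / n)) = (d + θ) * (n - #I) := by field_simp
    rw [h5, h6] at h4
    linarith
  rw [hIc] at hIle
  push_cast at hIle
  have hS1 : (d + θ) * #S ≤ 2 * n * θ := by linarith
  have hSR : (#S : ℝ) ≤ R := by
    rw [hR, le_div_iff₀ hdθ]; linarith
  exact false_of_separator hn hδv hδd hθpos hθδ hσ hA hAS hadj hb hS1 (by linarith)
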